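/- Let $S$ be a smooth $3$-manifold, $T\subseteq\mathbb{R}$ open, and let $\mathbf g$ be a smooth Lorentzian metric of signature $(-,+,+,+)$ on $T\times S$. Suppose that $\mathbf g$ is a solution of the Einstein equation (units with $c=1$) $$R_{\mu\nu}-\tfrac12 R\,\mathbf g_{\mu\nu}+\Lambda\,\mathbf g_{\mu\nu}=8\pi G\,\rho\,u_\mu u_\nu ,\qquad \Lambda\ge 0,\ G>0,$$ whose source is an irrotational, pressureless fluid (dust) with density $\rho>0$ and $4$-velocity $u$, and that the hypersurfaces $\Sigma(s)=\{s\}\times S$ form the fluid-flow-orthogonal foliation labelled by proper time: the fluid elements $X\in S$ have the world lines $s\mapsto(s,X)$, so that $u=\partial_s$; $\mathbf g(u,u)=-1$; and $u$ is orthogonal to every $\Sigma(s)$. Let $K_{ij}=-\nabla_i u_j$ be the extrinsic curvature of $\Sigma(s)$, $\Theta^i{}_j=-K^i{}_j$ the expansion tensor, $\Theta=\Theta^i{}_i$ the expansion scalar, and $\mathcal R$ the scalar curvature of the metric induced on $\Sigma(s)$. Let $t_i<t$ with $[t_i,t]\subseteq T$, and suppose that (i) $\mathcal R(X,t')=0$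 for all $X\in S$ and all $t'\in[t_i,t]$ (in particular, this holds if the slices are Ricci flat); (ii) $\Theta(X,t')>0$ for all $X\in S$ and all $t'\in[t_i,t)$. Then $\Theta(X,t)\neq 0$ for every $X\in S$, that is, pointwise isotropic turnaround does not occur on $\Sigma(t)$. Consequently $\Theta(X,t')>0$ for all $X\in S$ and all $t'\in[t_i,t]$: at no point does isotropic collapse occur during $[t_i,t]$. -/

import Mathlib

open scoped Manifold ContDiff

noncomputable section

namespace DustCosmology

/-! ### Coordinate tensor calculus on a coordinate space `V` with basis `b` -/

section Coordinates

variable {V : Type*} [NormedAddCommGroup V] [NormedSpace ℝ V]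
  {ι : Type*} [Fintype ι] [DecidableEq ι] (b : Module.Basis ι ℝ V)

/-- The partial derivative `∂_μ f` at `y`. -/
def pd (μ : ι) (f : V → ℝ) (y : V) : ℝ := fderiv ℝ f y (b μ)

/-- Christoffel symbols
`Γ^l_{mn} = ½ g^{lk} (∂_m g_{kn} + ∂_n g_{km} - ∂_k g_{mn})`. -/
def christoffel (g : V → Matrix ι ι ℝ) (l m n : ι) (y : V) : ℝ :=
  (1 / 2) * ∑ k, (g y)⁻¹ l k *
    (pd b m (fun z => g z k n) y + pd b n (fun z => g z k m) y - pd b k (fun z => g z m n) y)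

/-- The Ricci tensor
`R_{mn} = ∂_l Γ^l_{mn} - ∂_n Γ^l_{ml} + Γ^l_{lk} Γ^k_{mn} - Γ^l_{nk} Γ^k_{ml}`. -/
def ricci (g : V → Matrix ι ι ℝ) (m n : ι) (y : V) : ℝ :=
  (∑ l, (pd b l (christoffel b g l m n) y - pd b n (christoffel b g l m l) y)) +
    ∑ l, ∑ k, (christoffel b g l l k y * christoffel b g k m n y -
      christoffel b g l n k y * christoffel b g k m l y)

/-- The scalar curvature `g^{mn} R_{mn}`. -/
def scalarCurv (g : V → Matrix ι ι ℝ) (y : V) : ℝ :=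
  ∑ m, ∑ n, (g y)⁻¹ m n * ricci b g m n y

/-- The covariant derivative of a covector field, `∇_m α_n = ∂_m α_n - Γ^l_{mn} α_l`. -/
def covDeriv (g : V → Matrix ι ι ℝ) (α : V → ι → ℝ) (m n : ι) (y : V) : ℝ :=
  pd b m (fun z => α z n) y - ∑ l, christoffel b g l m n y * α y l

end Coordinates

/-! ### Tensor fields on a manifold (without boundary) and their components in charts -/

section Manifolds

variable {V : Type*} [NormedAddCommGroup V] [NormedSpace ℝ V]
  {H : Type*} [TopologicalSpace H] (I : ModelWithCorners ℝ V H)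
  {M : Type*} [TopologicalSpace M] [ChartedSpace H M]
  {ι : Type*} [Fintype ι] [DecidableEq ι] (b : Module.Basis ι ℝ V)

/-- Fields of bilinear forms on the tangent spaces of `M`. -/
abbrev BilinField (M : Type*) [TopologicalSpace M] [ChartedSpace H M] :=
  ∀ p : M, TangentSpace I p →ₗ[ℝ] TangentSpace I p →ₗ[ℝ] ℝ

/-- The coordinate vector `∂_μ`, in the chart at `p`, at the point with coordinates `y`. -/
def coordVec (p : M) (y : V) (μ : ι) : TangentSpace I ((extChartAt I p).symm y) :=
  mfderiv 𝓘(ℝ, V) I (extChartAt I p).symm y (b μ)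

/-- The matrix `g_{μν} = g(∂_μ, ∂_ν)`, in the chart at `p`, as a function of the coordinates. -/
def metricCoord (g : BilinField I M) (p : M) (y : V) : Matrix ι ι ℝ :=
  Matrix.of fun μ ν => g ((extChartAt I p).symm y) (coordVec I b p y μ) (coordVec I b p y ν)

/-- The covariant components `u_μ = g(u, ∂_μ)` of a vector field `u`, in the chart at `p`. -/
def lowerCoord (g : BilinField I M) (u : ∀ p : M, TangentSpace I p) (p : M) (y : V) (μ : ι) : ℝ :=
  g ((extChartAt I p).symm y) (u ((extChartAt I p).symm y)) (coordVec I b p y μ)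

/-- `g` is smooth on the open set `U`: its components in charts are smooth. -/
def IsSmoothOn (g : BilinField I M) (U : Set M) : Prop :=
  ∀ p ∈ U, ∀ μ ν : ι, ContDiffOn ℝ ∞ (fun y => metricCoord I b g p y μ ν)
    ((extChartAt I p).target ∩ (extChartAt I p).symm ⁻¹' U)

/-- The component `R_{μν}` of the Ricci tensor of `g` at `p`, in the chart at `p`. -/
def ricciAt (g : BilinField I M) (p : M) (μ ν : ι) : ℝ :=
  ricci b (metricCoord I b g p) μ ν (extChartAt I p p)

/-- The scalar curvature of `g` at `p`. -/
def scalarCurvAt (g : BilinField I M) (p : M) : ℝ :=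
  scalarCurv b (metricCoord I b g p) (extChartAt I p p)

/-- The component `∇_μ u_ν` at `p`, in the chart at `p`. -/
def nablaAt (g : BilinField I M) (u : ∀ p : M, TangentSpace I p) (p : M) (μ ν : ι) : ℝ :=
  covDeriv b (metricCoord I b g p) (lowerCoord I b g u p) μ ν (extChartAt I p p)

end Manifolds

/-- A symmetric bilinear form of signature `(-,+,…,+)`: it is negative on some vector and
positive definite on the orthogonal complement of that vector. -/
def IsLorentzForm {W : Type*} [AddCommGroup W] [Module ℝ W] (B : W →ₗ[ℝ] W →ₗ[ℝ] ℝ) : Prop :=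
  (∀ v w, B v w = B w v) ∧ ∃ v, B v v < 0 ∧ ∀ w, B v w = 0 → w ≠ 0 → 0 < B w w

/-! ### Spacetimes `ℝ × S` foliated by the slices `{s} × S` -/

/-- The model space of the spatial manifold. -/
abbrev E3 := EuclideanSpace ℝ (Fin 3)

/-- The model with corners of the spacetime `ℝ × S`. -/
abbrev I4 : ModelWithCorners ℝ (ℝ × E3) (ModelProd ℝ E3) := 𝓘(ℝ, ℝ).prod 𝓘(ℝ, E3)

/-- The standard basis of `ℝ³`. -/
def b3 : Module.Basis (Fin 3) ℝ E3 := (EuclideanSpace.basisFun (Fin 3) ℝ).toBasis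

/-- The standard basis of `ℝ × ℝ³`: `Sum.inl ()` is the time index, `Sum.inr i` are the spatial
indices. -/
def b4 : Module.Basis (Unit ⊕ Fin 3) ℝ (ℝ × E3) := (Module.Basis.singleton Unit ℝ).prod b3

section Spacetime

variable {S : Type*} [TopologicalSpace S] [ChartedSpace E3 S]

/-- The part of `ℝ × S` with time coordinate in `T`. -/
def region (S : Type*) (T : Set ℝ) : Set (ℝ × S) := T ×ˢ Set.univ

/-- `v`, tangent to `S` at `x`, as a vector tangent to the slice `{s} × S` at `(s, x)`. -/
def sliceVec (s : ℝ) (x : S) : TangentSpace 𝓘(ℝ, E3) x →ₗ[ℝ] TangentSpace I4 ((s, x) : ℝ × S) :=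
  LinearMap.inr ℝ ℝ E3

/-- The vector `∂_t`, tangent to the curve `s ↦ (s, x)`. -/
def timeVec (p : ℝ × S) : TangentSpace I4 p := ((1, 0) : ℝ × E3)

/-- The metric that `g` induces on the slice `{s} × S`. -/
def spatialMetric (g : BilinField I4 (ℝ × S)) (s : ℝ) : BilinField 𝓘(ℝ, E3) S :=
  fun x => (g (s, x)).compl₁₂ (sliceVec s x) (sliceVec s x)

/-- The scalar curvature `ℛ` of the slice `{s} × S` at `x`. -/
def spatialScalarCurv (g : BilinField I4 (ℝ × S)) (s : ℝ) (x : S) : ℝ :=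
  scalarCurvAt 𝓘(ℝ, E3) b3 (spatialMetric g s) x

/-- The inverse `h^{ij}` of the spatial metric at `x`, in the chart at `x`. -/
def spatialInv (g : BilinField I4 (ℝ × S)) (s : ℝ) (x : S) : Matrix (Fin 3) (Fin 3) ℝ :=
  (metricCoord 𝓘(ℝ, E3) b3 (spatialMetric g s) x (extChartAt 𝓘(ℝ, E3) x x))⁻¹

/-- The extrinsic curvature `K_{ij} = -∇_i u_j` of the slice `{s} × S` with unit normal `u`. -/
def extrinsicCurv (g : BilinField I4 (ℝ × S)) (u : ∀ p : ℝ × S, TangentSpace I4 p)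
    (s : ℝ) (x : S) (i j : Fin 3) : ℝ :=
  -nablaAt I4 b4 g u (s, x) (Sum.inr i) (Sum.inr j)

/-- The expansion tensor `Θ^i_j = -K^i_j`. -/
def expansionTensor (g : BilinField I4 (ℝ × S)) (u : ∀ p : ℝ × S, TangentSpace I4 p)
    (s : ℝ) (x : S) (i j : Fin 3) : ℝ :=
  -∑ k, spatialInv g s x i k * extrinsicCurv g u s x k j

/-- The expansion scalar `Θ = Θ^i_i`. -/
def expansion (g : BilinField I4 (ℝ × S)) (u : ∀ p : ℝ × S, TangentSpace I4 p)
    (s : ℝ) (x : S) : ℝ :=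
  ∑ i, expansionTensor g u s x i i

/-- `g` is a smooth Lorentzian metric on the spacetime region with times in `T`. -/
structure IsSpacetimeMetric (T : Set ℝ) (g : BilinField I4 (ℝ × S)) : Prop where
  smooth : IsSmoothOn I4 b4 g (region S T)
  lorentz : ∀ p ∈ region S T, IsLorentzForm (g p)

/-- The slices form a flow-orthogonal foliation for the fluid with 4-velocity `u`: the fluid
elements have the world lines `s ↦ (s, x)`, on which `s` is the proper time, and these are
orthogonal to the slices `{s} × S`. -/
structure IsFlowOrthogonal (T : Set ℝ) (g : BilinField I4 (ℝ × S))
    (u : ∀ p : ℝ × S, TangentSpace I4 p) : Prop where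
  comoving : ∀ p ∈ region S T, u p = timeVec p
  unit : ∀ p ∈ region S T, g p (u p) (u p) = -1
  orthogonal : ∀ s ∈ T, ∀ x : S, ∀ v : TangentSpace 𝓘(ℝ, E3) x,
    g (s, x) (u (s, x)) (sliceVec s x v) = 0

/-- The vorticity of `u` vanishes: `∇_μ u_ν` is symmetric on the orthogonal complement of `u`
(which is spanned by the spatial coordinate vectors). -/
def IsIrrotational (T : Set ℝ) (g : BilinField I4 (ℝ × S))
    (u : ∀ p : ℝ × S, TangentSpace I4 p) : Prop :=
  ∀ p ∈ region S T, ∀ i j : Fin 3,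
    nablaAt I4 b4 g u p (Sum.inr i) (Sum.inr j) = nablaAt I4 b4 g u p (Sum.inr j) (Sum.inr i)

/-- The energy-momentum tensor `T_{μν} = ρ u_μ u_ν` of pressureless matter at `p`. -/
def dustStress (g : BilinField I4 (ℝ × S)) (u : ∀ p : ℝ × S, TangentSpace I4 p)
    (ρ : ℝ × S → ℝ) (p : ℝ × S) (μ ν : Unit ⊕ Fin 3) : ℝ :=
  ρ p * lowerCoord I4 b4 g u p (extChartAt I4 p p) μ * lowerCoord I4 b4 g u p (extChartAt I4 p p) ν

/-- The Einstein equation `R_{μν} - ½ R g_{μν} + Λ g_{μν} = 8 π G T_{μν}` with dust source. -/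
def SolvesEinsteinDust (G Λ : ℝ) (T : Set ℝ) (g : BilinField I4 (ℝ × S))
    (u : ∀ p : ℝ × S, TangentSpace I4 p) (ρ : ℝ × S → ℝ) : Prop :=
  ∀ p ∈ region S T, ∀ μ ν : Unit ⊕ Fin 3,
    ricciAt I4 b4 g p μ ν
        - (1 / 2) * scalarCurvAt I4 b4 g p * metricCoord I4 b4 g p (extChartAt I4 p p) μ ν
        + Λ * metricCoord I4 b4 g p (extChartAt I4 p p) μ ν
      = 8 * Real.pi * G * dustStress g u ρ p μ ν

end Spacetime

end DustCosmology

end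

open scoped Manifold ContDiff

noncomputable section

namespace DustCosmology

/-! ### Partial derivatives -/

section PartialDerivatives

variable {V : Type*} [NormedAddCommGroup V] [NormedSpace ℝ V]
  {ι : Type*} (b : Module.Basis ι ℝ V)

/-! The theorem follows from the Hamiltonian constraint `hamiltonian_constraint`, the time-time
component of the Einstein equation: ℛ + Θ² - Θ^i_j Θ^j_i = 16πGρ + 2Λ. The expansion tensor is
self-adjoint for the positive definite spatial metric, so Θ^i_j Θ^j_i ≥ 0. Where ℛ = 0 this gives Θ²
≥ 16πGρ + 2Λ > 0, hence Θ ≠ 0 (`expansion_ne_zero_of_flat`). At the final time Θ is a limit of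
positive values, hence nonnegative, hence positive.

To derive the constraint, flow-orthogonality puts the metric in the form -dt² + h_{ij} dx^i dx^j in
product charts (`metricCoord_eq_normalMetric`). The contracted Gauss equation `normalMetric_gauss`
is then computed from the Christoffel symbols. The sign of the quadratic term is
`normalExpansion_sq_nonneg`. -/

theorem pd_congr {f f' : V → ℝ} {y : V} (h : f =ᶠ[nhds y] f') (μ : ι) :
    pd b μ f y = pd b μ f' y := by
  rw [pd, pd, h.fderiv_eq]

theorem pd_const (μ : ι) (c : ℝ) (y : V) : pd b μ (fun _ => c) y = 0 := by
  simp [pd]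

theorem pd_const_mul (μ : ι) (c : ℝ) {f : V → ℝ} {y : V} (hf : DifferentiableAt ℝ f y) :
    pd b μ (fun z => c * f z) y = c * pd b μ f y := by
  simp [pd, fderiv_const_mul hf]

theorem pd_mul (μ : ι) {f f' : V → ℝ} {y : V} (hf : DifferentiableAt ℝ f y)
    (hf' : DifferentiableAt ℝ f' y) :
    pd b μ (fun z => f z * f' z) y = pd b μ f y * f' y + f y * pd b μ f' y := by
  simp [pd, fderiv_fun_mul hf hf']
  ring

theorem pd_sum (μ : ι) {κ : Type*} (s : Finset κ) {f : κ → V → ℝ} {y : V}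
    (hf : ∀ k ∈ s, DifferentiableAt ℝ (f k) y) :
    pd b μ (fun z => ∑ k ∈ s, f k z) y = ∑ k ∈ s, pd b μ (f k) y := by
  simp [pd, fderiv_fun_sum hf]

theorem contDiffOn_pd (μ : ι) {f : V → ℝ} {U : Set V} (hU : IsOpen U)
    (hf : ContDiffOn ℝ ∞ f U) : ContDiffOn ℝ ∞ (pd b μ f) U :=
  (hf.fderiv_of_isOpen hU (by simp)).clm_apply contDiffOn_const

end PartialDerivatives

/-! ### Matrix-valued functions: smoothness, inverses, traces -/

section MatrixFields

variable {V : Type*} [NormedAddCommGroup V] [NormedSpace ℝ V]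
  {ι : Type*} [Fintype ι] [DecidableEq ι]

theorem contDiffOn_det {A : V → Matrix ι ι ℝ} {U : Set V}
    (hA : ∀ i j, ContDiffOn ℝ ∞ (fun z => A z i j) U) :
    ContDiffOn ℝ ∞ (fun z => (A z).det) U := by
  simp only [Matrix.det_apply]
  exact ContDiffOn.sum fun σ _ => (contDiffOn_prod fun i _ => hA _ _).const_smul _

theorem contDiffOn_inv {A : V → Matrix ι ι ℝ} {U : Set V}
    (hA : ∀ i j, ContDiffOn ℝ ∞ (fun z => A z i j) U) (hdet : ∀ z ∈ U, (A z).det ≠ 0) (i j : ι) :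
    ContDiffOn ℝ ∞ (fun z => (A z)⁻¹ i j) U := by
  -- Cramer's rule: each entry of the inverse is a quotient of determinants, so smoothness reduces
  -- to `contDiffOn_det`.
  have h : (fun z => (A z)⁻¹ i j) = fun z => (A z).det⁻¹ * ((A z).updateRow j (Pi.single i 1)).det := by
    funext z
    rw [Matrix.inv_def, Matrix.smul_apply, Matrix.adjugate_apply, Ring.inverse_eq_inv', smul_eq_mul]
  rw [h]
  refine ((contDiffOn_det hA).inv hdet).mul (contDiffOn_det fun k l => ?_)
  by_cases hk : k = j
  · subst hk
    simpa using contDiffOn_const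
  · simpa [Matrix.updateRow_ne hk] using hA k l

/-- The derivative of the inverse matrix: `∂(A⁻¹) = -A⁻¹ (∂A) A⁻¹`. -/
theorem pd_inv {κ : Type*} (b : Module.Basis κ ℝ V) (μ : κ) {A : V → Matrix ι ι ℝ} {U : Set V}
    (hU : IsOpen U) (hA : ∀ i j, ContDiffOn ℝ ∞ (fun z => A z i j) U)
    (hdet : ∀ z ∈ U, (A z).det ≠ 0) {y : V} (hy : y ∈ U) :
    (Matrix.of fun i j => pd b μ (fun z => (A z)⁻¹ i j) y) =
      -((A y)⁻¹ * (Matrix.of fun i j => pd b μ (fun z => A z i j) y) * (A y)⁻¹) := by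
  set P : Matrix ι ι ℝ := Matrix.of fun i j => pd b μ (fun z => (A z)⁻¹ i j) y
  set D : Matrix ι ι ℝ := Matrix.of fun i j => pd b μ (fun z => A z i j) y
  have hUy := hU.mem_nhds hy
  have hdA : ∀ i j, DifferentiableAt ℝ (fun z => A z i j) y := fun i j =>
    ((hA i j).contDiffAt hUy).differentiableAt (by simp)
  have hdI : ∀ i j, DifferentiableAt ℝ (fun z => (A z)⁻¹ i j) y := fun i j =>
    ((contDiffOn_inv hA hdet i j).contDiffAt hUy).differentiableAt (by simp)
  -- Differentiate A⁻¹ A = 1, which holds near `y`.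
  have key : P * A y + (A y)⁻¹ * D = 0 := by
    ext i j
    have h1 : pd b μ (fun z => ∑ k, (A z)⁻¹ i k * A z k j) y = 0 := by
      rw [pd_congr b (f' := fun _ => (1 : Matrix ι ι ℝ) i j), pd_const]
      filter_upwards [hUy] with z hz
      rw [← Matrix.mul_apply, Matrix.nonsing_inv_mul _ (isUnit_iff_ne_zero.2 (hdet z hz))]
    rw [pd_sum b μ Finset.univ (f := fun k z => (A z)⁻¹ i k * A z k j)
      fun k _ => (hdI i k).mul (hdA k j)] at h1
    rw [Matrix.add_apply, Matrix.mul_apply, Matrix.mul_apply, ← Finset.sum_add_distrib,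
      Matrix.zero_apply, ← h1]
    exact Finset.sum_congr rfl fun k _ => (pd_mul b μ (hdI i k) (hdA k j)).symm
  have hu : IsUnit (A y).det := isUnit_iff_ne_zero.2 (hdet y hy)
  calc P = P * A y * (A y)⁻¹ := by rw [Matrix.mul_assoc, Matrix.mul_nonsing_inv _ hu, mul_one]
    _ = -((A y)⁻¹ * D * (A y)⁻¹) := by
      rw [eq_neg_of_add_eq_zero_left key, neg_mul]

open scoped MatrixOrder in
/-- A real symmetric matrix `k` satisfies `tr (h k h k) ≥ 0` when `h` is positive definite. -/
theorem trace_mul_symm_sq_nonneg {h k : Matrix ι ι ℝ} (hh : h.PosDef) (hk : k.IsSymm) :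
    0 ≤ (h * k * (h * k)).trace := by
  obtain ⟨B, hB⟩ := CStarAlgebra.nonneg_iff_eq_star_mul_self.mp hh.posSemidef.nonneg
  rw [Matrix.star_eq_conjTranspose] at hB
  -- With h = BᴴB, cyclicity turns the trace into tr(MᴴM) for the Hermitian matrix M = B k Bᴴ.
  have e : (h * k * (h * k)).trace =
      ((B * k * B.conjTranspose).conjTranspose * (B * k * B.conjTranspose)).trace := by
    have hk' : k.conjTranspose = k := 
      (Matrix.conjTranspose_eq_transpose_of_trivial k).trans hk
    rw [Matrix.conjTranspose_mul, Matrix.conjTranspose_mul, Matrix.conjTranspose_conjTranspose, hk',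
      hB, Matrix.trace_mul_comm (B * (k * B.conjTranspose)), Matrix.mul_assoc, Matrix.mul_assoc,
      Matrix.trace_mul_comm B.conjTranspose]
    simp only [Matrix.mul_assoc]
  rw [e]
  exact (Matrix.posSemidef_conjTranspose_mul_self _).trace_nonneg

end MatrixFields

/-! ### Gaussian normal coordinates -/

section NormalCoordinates

variable {V : Type*} [NormedAddCommGroup V] [NormedSpace ℝ V]
  {ι : Type*} (b : Module.Basis ι ℝ V)

/-- The basis of `ℝ × V` formed by the time direction and the basis `b` of `V`. -/
abbrev timeBasis : Module.Basis (Unit ⊕ ι) ℝ (ℝ × V) := (Module.Basis.singleton Unit ℝ).prod b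

theorem pd_timeBasis_inr (i : ι) {f : ℝ × V → ℝ} {y : ℝ × V} (hf : DifferentiableAt ℝ f y) :
    pd (timeBasis b) (Sum.inr i) f y = pd b i (fun x => f (y.1, x)) y.2 := by
  have h := hf.hasFDerivAt.comp y.2 (hasFDerivAt_prodMk_right (𝕜 := ℝ) y.1 y.2)
  have h' : fderiv ℝ (fun x => f (y.1, x)) y.2 = _ := h.fderiv
  simp [pd, h', timeBasis]

variable [Fintype ι] [DecidableEq ι]

/-- The matrix of the metric `-dt² + h_{ij} dx^i dx^j`. -/
def normalMetric (h : ℝ × V → Matrix ι ι ℝ) (y : ℝ × V) : Matrix (Unit ⊕ ι) (Unit ⊕ ι) ℝ :=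
  Matrix.fromBlocks (-1) 0 0 (h y)

/-- The expansion tensor `½ h^{ik} ∂_t h_{kj}`. -/
def normalExpansion (h : ℝ × V → Matrix ι ι ℝ) (i j : ι) (y : ℝ × V) : ℝ :=
  (1 / 2) * ∑ k, (h y)⁻¹ i k * pd (timeBasis b) (Sum.inl ()) (fun z => h z k j) y

section Christoffel

variable {h : ℝ × V → Matrix ι ι ℝ} {y : ℝ × V}

omit [NormedAddCommGroup V] [NormedSpace ℝ V] in
theorem inv_normalMetric (hdet : (h y).det ≠ 0) :
    (normalMetric h y)⁻¹ = Matrix.fromBlocks (-1) 0 0 (h y)⁻¹ := by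
  apply Matrix.inv_eq_left_inv
  simp [normalMetric, Matrix.fromBlocks_multiply,
    Matrix.nonsing_inv_mul _ (isUnit_iff_ne_zero.2 hdet)]

/-- The time-time and time-space components of the metric are constant, so only derivatives of h
contribute. The nonzero symbols are Γ^t_{ij} = ½ ∂_t h_{ij}, Γ^i_{tj} = Γ^i_{jt} = Θ^i_j, and the
Γ^i_{jk} of the slice. -/
theorem christoffel_inl_inl_left (hdet : (h y).det ≠ 0) (m : Unit ⊕ ι) :
    christoffel (timeBasis b) (normalMetric h) (Sum.inl ()) (Sum.inl ()) m y = 0 := by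
  rw [christoffel, inv_normalMetric hdet]
  rcases m with ⟨⟩ | m <;> simp [normalMetric, pd_const]

theorem christoffel_inl_inl_right (hdet : (h y).det ≠ 0) (m : Unit ⊕ ι) :
    christoffel (timeBasis b) (normalMetric h) (Sum.inl ()) m (Sum.inl ()) y = 0 := by
  rw [christoffel, inv_normalMetric hdet]
  rcases m with ⟨⟩ | m <;> simp [normalMetric, pd_const]

theorem christoffel_inl_inr_inr (hdet : (h y).det ≠ 0) (i j : ι) :
    christoffel (timeBasis b) (normalMetric h) (Sum.inl ()) (Sum.inr i) (Sum.inr j) y =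
      (1 / 2) * pd (timeBasis b) (Sum.inl ()) (fun z => h z i j) y := by
  rw [christoffel, inv_normalMetric hdet]
  simp [normalMetric, pd_const]

theorem christoffel_inr_inl_inl (i : ι) :
    christoffel (timeBasis b) (normalMetric h) (Sum.inr i) (Sum.inl ()) (Sum.inl ()) y = 0 := by
  simp [christoffel, normalMetric, pd_const]

theorem christoffel_inr_inl_inr (hdet : (h y).det ≠ 0) (i j : ι) :
    christoffel (timeBasis b) (normalMetric h) (Sum.inr i) (Sum.inl ()) (Sum.inr j) y =
      normalExpansion b h i j y := by
  rw [christoffel, inv_normalMetric hdet]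
  simp [normalMetric, pd_const, normalExpansion]

theorem christoffel_inr_inr_inl (hdet : (h y).det ≠ 0) (i j : ι) :
    christoffel (timeBasis b) (normalMetric h) (Sum.inr i) (Sum.inr j) (Sum.inl ()) y =
      normalExpansion b h i j y := by
  rw [christoffel, inv_normalMetric hdet]
  simp [normalMetric, pd_const, normalExpansion]

theorem christoffel_inr_inr_inr (hdet : (h y).det ≠ 0)
    (hd : ∀ i j, DifferentiableAt ℝ (fun z => h z i j) y) (i j k : ι) :
    christoffel (timeBasis b) (normalMetric h) (Sum.inr i) (Sum.inr j) (Sum.inr k) y =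
      christoffel b (fun x => h (y.1, x)) i j k y.2 := by
  rw [christoffel, inv_normalMetric hdet]
  simp [christoffel, normalMetric, pd_const, pd_timeBasis_inr b _ (hd _ _)]

end Christoffel

/-! ### Smoothness and locality of the curvature expressions -/

theorem contDiffOn_christoffel {g : V → Matrix ι ι ℝ} {U : Set V} (hU : IsOpen U)
    (hg : ∀ i j, ContDiffOn ℝ ∞ (fun z => g z i j) U) (hdet : ∀ z ∈ U, (g z).det ≠ 0) (l m n : ι) :
    ContDiffOn ℝ ∞ (christoffel b g l m n) U :=
  contDiffOn_const.mul <| ContDiffOn.sum fun k _ => (contDiffOn_inv hg hdet l k).mul <|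
    ((contDiffOn_pd b m hU (hg _ _)).add (contDiffOn_pd b n hU (hg _ _))).sub
      (contDiffOn_pd b k hU (hg _ _))

theorem christoffel_congr {g g' : V → Matrix ι ι ℝ} {y : V} (hg : g =ᶠ[nhds y] g') (l m n : ι) :
    christoffel b g l m n y = christoffel b g' l m n y := by
  have hp : ∀ μ i j, pd b μ (fun z => g z i j) y = pd b μ (fun z => g' z i j) y := fun μ i j =>
    pd_congr b (hg.mono fun w hw => by simp only [hw]) μ
  simp only [christoffel, hp, hg.eq_of_nhds]

theorem ricci_congr {g g' : V → Matrix ι ι ℝ} {y : V} (hg : g =ᶠ[nhds y] g') (m n : ι) :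
    ricci b g m n y = ricci b g' m n y := by
  have hc : ∀ l m n, christoffel b g l m n =ᶠ[nhds y] christoffel b g' l m n := fun l m n =>
    hg.eventuallyEq_nhds.mono fun z hz => christoffel_congr b hz l m n
  simp only [ricci, pd_congr b (hc _ _ _), (hc _ _ _).eq_of_nhds]

/-! ### Ricci tensor of -dt² + h and the Gauss equation -/

variable {h : ℝ × V → Matrix ι ι ℝ} {U : Set (ℝ × V)} (hU : IsOpen U)
  (hh : ∀ i j, ContDiffOn ℝ ∞ (fun z => h z i j) U) (hdet : ∀ z ∈ U, (h z).det ≠ 0)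
  {y : ℝ × V} (hy : y ∈ U)

-- The geometric form of the Raychaudhuri equation. Only -∂_t Γ^i_{ti} and -Γ^i_{tj} Γ^j_{ti}
-- survive.
include hU hdet hy in
theorem ricci_normalMetric_inl_inl :
    ricci (timeBasis b) (normalMetric h) (Sum.inl ()) (Sum.inl ()) y =
      -(∑ i, pd (timeBasis b) (Sum.inl ()) (normalExpansion b h i i) y) -
        ∑ i, ∑ j, normalExpansion b h i j y * normalExpansion b h j i y := by
  have hev : ∀ᶠ z in nhds y, z ∈ U := hU.mem_nhds hy
  have e1 : ∀ m μ, pd (timeBasis b) μ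
      (christoffel (timeBasis b) (normalMetric h) (Sum.inl ()) (Sum.inl ()) m) y = 0 := fun m μ => by
    rw [pd_congr _ (hev.mono fun z hz => christoffel_inl_inl_left b (hdet z hz) m), pd_const]
  have e2 : ∀ i μ, pd (timeBasis b) μ
      (christoffel (timeBasis b) (normalMetric h) (Sum.inr i) (Sum.inl ()) (Sum.inl ())) y = 0 :=
    fun i μ => by
    rw [pd_congr _ (hev.mono fun z _ => christoffel_inr_inl_inl b i), pd_const]
  have e3 : ∀ i j μ, pd (timeBasis b) μ
      (christoffel (timeBasis b) (normalMetric h) (Sum.inr i) (Sum.inl ()) (Sum.inr j)) y =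
      pd (timeBasis b) μ (normalExpansion b h i j) y :=
    fun i j μ => pd_congr _ (hev.mono fun z hz => christoffel_inr_inl_inr b (hdet z hz) i j) μ
  have hd := hdet y hy
  simp [ricci, e1, e2, e3, christoffel_inl_inl_left b hd, 
    christoffel_inr_inl_inl b, christoffel_inr_inl_inr b hd]
  ring

-- The second time derivative is ∂_t Γ^t_{ij}. The last two sums are Γ^t_{jk} Γ^k_{it} and Γ^k_{jt}
-- Γ^t_{ik}; they stay separate because h is not assumed symmetric here.
include hU hh hdet hy in
theorem ricci_normalMetric_inr_inr (i j : ι) :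
    ricci (timeBasis b) (normalMetric h) (Sum.inr i) (Sum.inr j) y =
      ricci b (fun x => h (y.1, x)) i j y.2
      + (1 / 2) * pd (timeBasis b) (Sum.inl ())
          (pd (timeBasis b) (Sum.inl ()) (fun z => h z i j)) y
      + (∑ l, normalExpansion b h l l y) *
          ((1 / 2) * pd (timeBasis b) (Sum.inl ()) (fun z => h z i j) y)
      - (∑ k, (1 / 2) * pd (timeBasis b) (Sum.inl ()) (fun z => h z j k) y *
          normalExpansion b h k i y)
      - ∑ k, normalExpansion b h k j y *
          ((1 / 2) * pd (timeBasis b) (Sum.inl ()) (fun z => h z i k) y) := by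
  have hev : ∀ᶠ z in nhds y, z ∈ U := hU.mem_nhds hy
  have hdh : ∀ z ∈ U, ∀ i j, DifferentiableAt ℝ (fun z => h z i j) z := fun z hz i j =>
    ((hh i j).contDiffAt (hU.mem_nhds hz)).differentiableAt (by simp)
  have e1 : ∀ m μ, pd (timeBasis b) μ
      (christoffel (timeBasis b) (normalMetric h) (Sum.inl ()) m (Sum.inl ())) y = 0 := fun m μ => by
    rw [pd_congr _ (hev.mono fun z hz => christoffel_inl_inl_right b (hdet z hz) m), pd_const]
  have e2 : ∀ μ, pd (timeBasis b) μ
      (christoffel (timeBasis b) (normalMetric h) (Sum.inl ()) (Sum.inr i) (Sum.inr j)) y =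
      (1 / 2) * pd (timeBasis b) μ (pd (timeBasis b) (Sum.inl ()) (fun z => h z i j)) y :=
    fun μ => by
    rw [pd_congr _ (hev.mono fun z hz => christoffel_inl_inr_inr b (hdet z hz) i j), pd_const_mul]
    exact ((contDiffOn_pd _ _ hU (hh i j)).contDiffAt hev).differentiableAt (by simp)
  have e3 : ∀ l m n k, pd (timeBasis b) (Sum.inr k)
      (christoffel (timeBasis b) (normalMetric h) (Sum.inr l) (Sum.inr m) (Sum.inr n)) y =
      pd b k (christoffel b (fun x => h (y.1, x)) l m n) y.2 := fun l m n k => by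
    have hg4 : ∀ μ ν, ContDiffOn ℝ ∞ (fun z => normalMetric h z μ ν) U := by
      rintro (μ | μ) (ν | ν)
      · exact contDiffOn_const
      · exact contDiffOn_const
      · exact contDiffOn_const
      · exact hh μ ν
    have hdet4 : ∀ z ∈ U, (normalMetric h z).det ≠ 0 := fun z hz => by
      simp [normalMetric, Matrix.det_fromBlocks_zero₂₁, hdet z hz]
    rw [pd_timeBasis_inr b k (((contDiffOn_christoffel (timeBasis b) hU hg4 hdet4 _ _ _).contDiffAt
      hev).differentiableAt (by simp))]
    -- A spatial derivative sees only the slice through `y`, so agreement along that slice near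
    -- `y.2` suffices.
    refine pd_congr b ?_ k
    have hc : Filter.Tendsto (fun x : V => (y.1, x)) (nhds y.2) (nhds y) :=
      (by fun_prop : Continuous fun x : V => (y.1, x)).tendsto' _ _ rfl
    filter_upwards [hc.eventually hev] with x hx
    exact christoffel_inr_inr_inr b (hdet _ hx) (hdh _ hx) l m n
  have hd := hdet y hy
  simp only [ricci, Fintype.sum_sum_type, Finset.univ_unique, Finset.sum_singleton,
    PUnit.default_eq_unit, e1, e2, e3, christoffel_inl_inl_left b hd,
    christoffel_inl_inl_right b hd, christoffel_inl_inr_inr b hd, christoffel_inr_inr_inl b hd,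
    christoffel_inr_inr_inr b hd (hdh y hy), Finset.sum_add_distrib, Finset.sum_sub_distrib,
    Finset.sum_mul]
  simp
  ring

include hU hh hdet hy in
/-- The Gauss equation, contracted: twice the component of the Einstein tensor along the unit normal
of the slices. -/
theorem normalMetric_gauss (hsymm : (h y).IsSymm) :
    ricci (timeBasis b) (normalMetric h) (Sum.inl ()) (Sum.inl ()) y +
      ∑ i, ∑ j, (h y)⁻¹ i j * ricci (timeBasis b) (normalMetric h) (Sum.inr i) (Sum.inr j) y =
    scalarCurv b (fun x => h (y.1, x)) y.2 + (∑ i, normalExpansion b h i i y) ^ 2 -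
      ∑ i, ∑ j, normalExpansion b h i j y * normalExpansion b h j i y := by
  have hev : U ∈ nhds y := hU.mem_nhds hy
  -- With Θ = ½AD everything becomes a trace. The time-time part is -½ tr(A D2) + ¼ tr(ADAD), and
  -- the spatial trace is ℛ + ½ tr(A D2) + ¼ (tr AD)² - ½ tr(ADAD). In the sum the second time
  -- derivatives cancel.
  set A : Matrix ι ι ℝ := (h y)⁻¹ with hA
  set D : Matrix ι ι ℝ := Matrix.of fun i j => pd (timeBasis b) (Sum.inl ()) (fun z => h z i j) y
    with hD
  set D2 : Matrix ι ι ℝ := Matrix.of fun i j => pd (timeBasis b) (Sum.inl ())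
    (pd (timeBasis b) (Sum.inl ()) (fun z => h z i j)) y with hD2
  have hAs : ∀ i j, A i j = A j i := fun i j => (Matrix.IsSymm.apply (hsymm.inv) i j).symm
  have hθ : ∀ i j, normalExpansion b h i j y = (1 / 2) * (A * D) i j := fun i j => by
    rw [Matrix.mul_apply]; rfl
  have hdθ : ∀ i, pd (timeBasis b) (Sum.inl ()) (normalExpansion b h i i) y =
      (1 / 2) * (A * D2) i i - (1 / 2) * (A * D * (A * D)) i i := fun i => by
    have dI : ∀ k, DifferentiableAt ℝ (fun z => (h z)⁻¹ i k) y := fun k =>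
      ((contDiffOn_inv hh hdet i k).contDiffAt hev).differentiableAt (by simp)
    have dD : ∀ k, DifferentiableAt ℝ (pd (timeBasis b) (Sum.inl ()) (fun z => h z k i)) y :=
      fun k => ((contDiffOn_pd _ _ hU (hh k i)).contDiffAt hev).differentiableAt (by simp)
    have dM : ∀ k, DifferentiableAt ℝ
        (fun z => (h z)⁻¹ i k * pd (timeBasis b) (Sum.inl ()) (fun z => h z k i) z) y :=
      fun k => (dI k).mul (dD k)
    have hP : ∀ k, pd (timeBasis b) (Sum.inl ()) (fun z => (h z)⁻¹ i k) y = -(A * D * A) i k :=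
      fun k => congrFun (congrFun (pd_inv (timeBasis b) (Sum.inl ()) hU hh hdet hy) i) k
    have e : normalExpansion b h i i = fun z => (1 / 2) * ∑ k, (h z)⁻¹ i k *
      pd (timeBasis b) (Sum.inl ()) (fun z => h z k i) z := rfl
    rw [e, pd_const_mul _ _ _ (DifferentiableAt.fun_sum fun k _ => dM k),
      pd_sum _ _ _ fun k _ => dM k, ← mul_sub, ← Matrix.mul_assoc, Matrix.mul_apply,
      Matrix.mul_apply, ← Finset.sum_sub_distrib]
    congr 1
    refine Finset.sum_congr rfl fun k _ => ?_
    rw [pd_mul _ _ (dI k) (dD k), hP]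
    simp only [hD, hD2, hA, Matrix.of_apply]
    ring
  have t1 : ∑ i, ∑ j, A i j * D2 i j = (A * D2).trace := by
    simp only [Matrix.trace, Matrix.diag, Matrix.mul_apply]
    rw [Finset.sum_comm]
    exact Finset.sum_congr rfl fun i _ => Finset.sum_congr rfl fun j _ => by rw [hAs]
  have t2 : ∑ i, ∑ j, A i j * D i j = (A * D).trace := by
    simp only [Matrix.trace, Matrix.diag, Matrix.mul_apply]
    rw [Finset.sum_comm]
    exact Finset.sum_congr rfl fun i _ => Finset.sum_congr rfl fun j _ => by rw [hAs]
  have t3 : ∑ i, ∑ j, A i j * ∑ k, D j k * (A * D) k i = (A * D * (A * D)).trace := by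
    simp only [Matrix.trace, Matrix.diag, Matrix.mul_assoc, Matrix.mul_apply (M := A) (N := D * (A * D)),
      Matrix.mul_apply (M := D) (N := A * D)]
  have t4 : ∑ i, ∑ j, A i j * ∑ k, (A * D) k j * D i k = (A * D * (A * D)).trace := by
    rw [Matrix.mul_assoc, Matrix.trace_mul_comm]
    simp only [Matrix.trace, Matrix.diag, 
      Matrix.mul_apply (M := D * (A * D)), Matrix.mul_apply (M := D) (N := A * D)]
    refine Finset.sum_congr rfl fun i _ => Finset.sum_congr rfl fun j _ => ?_
    rw [hAs, mul_comm]
    congr 1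
    exact Finset.sum_congr rfl fun k _ => mul_comm _ _
  have t5 : ∑ i, ∑ j, (A * D) i j * (A * D) j i = (A * D * (A * D)).trace := by
    simp only [Matrix.trace, Matrix.diag, Matrix.mul_apply (M := A * D) (N := A * D)]
  have hR : ∀ i j, A i j * ricci (timeBasis b) (normalMetric h) (Sum.inr i) (Sum.inr j) y =
      A i j * ricci b (fun x => h (y.1, x)) i j y.2 + (1 / 2) * (A i j * D2 i j)
      + (1 / 4) * (A * D).trace * (A i j * D i j)
      - (1 / 4) * (A i j * ∑ k, D j k * (A * D) k i)
      - (1 / 4) * (A i j * ∑ k, (A * D) k j * D i k) := fun i j => by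
    rw [ricci_normalMetric_inr_inr b hU hh hdet hy]
    have q1 : ∑ k, (1 / 2) * pd (timeBasis b) (Sum.inl ()) (fun z => h z j k) y *
        normalExpansion b h k i y = (1 / 4) * ∑ k, D j k * (A * D) k i := by
      rw [Finset.mul_sum]
      refine Finset.sum_congr rfl fun k _ => ?_
      rw [hθ]
      simp only [hD, Matrix.of_apply]
      ring
    have q2 : ∑ k, normalExpansion b h k j y *
        ((1 / 2) * pd (timeBasis b) (Sum.inl ()) (fun z => h z i k) y) =
        (1 / 4) * ∑ k, (A * D) k j * D i k := by
      rw [Finset.mul_sum]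
      refine Finset.sum_congr rfl fun k _ => ?_
      rw [hθ]
      simp only [hD, Matrix.of_apply]
      ring
    have q3 : ∑ l, normalExpansion b h l l y = (1 / 2) * (A * D).trace := by
      simp only [hθ, ← Finset.mul_sum, Matrix.trace, Matrix.diag]
    rw [q1, q2, q3]
    simp only [hD, hD2, Matrix.of_apply]
    ring
  have s1 : ∑ i, pd (timeBasis b) (Sum.inl ()) (normalExpansion b h i i) y =
      (1 / 2) * (A * D2).trace - (1 / 2) * (A * D * (A * D)).trace := by
    simp only [hdθ, Finset.sum_sub_distrib, ← Finset.mul_sum, Matrix.trace, Matrix.diag]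
  have s2 : ∑ i, ∑ j, normalExpansion b h i j y * normalExpansion b h j i y =
      (1 / 4) * (A * D * (A * D)).trace := by
    rw [← t5]
    simp only [hθ, Finset.mul_sum]
    exact Finset.sum_congr rfl fun i _ => Finset.sum_congr rfl fun j _ => by ring
  have s3 : ∑ i, normalExpansion b h i i y = (1 / 2) * (A * D).trace := by
    simp only [hθ, ← Finset.mul_sum, Matrix.trace, Matrix.diag]
  have s4 : scalarCurv b (fun x => h (y.1, x)) y.2 =
      ∑ i, ∑ j, A i j * ricci b (fun x => h (y.1, x)) i j y.2 := rfl
  rw [ricci_normalMetric_inl_inl b hU hdet hy, s1, s2, s3, s4]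
  simp only [hR, Finset.sum_add_distrib, Finset.sum_sub_distrib, ← Finset.mul_sum]
  rw [t1, t2, t3, t4]
  ring

include hU hh hdet in
theorem contDiffOn_normalExpansion (i j : ι) : ContDiffOn ℝ ∞ (normalExpansion b h i j) U :=
  contDiffOn_const.mul <| ContDiffOn.sum fun k _ =>
    (contDiffOn_inv hh hdet i k).mul (contDiffOn_pd _ _ hU (hh k j))

-- Θ need not be a symmetric matrix, so the sum is not visibly a sum of squares. But Θ = h⁻¹k with k
-- = ½ ∂_t h symmetric, and `trace_mul_symm_sq_nonneg` applies.
include hU hy in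
theorem normalExpansion_sq_nonneg (hpos : ∀ z ∈ U, (h z).PosDef) :
    0 ≤ ∑ i, ∑ j, normalExpansion b h i j y * normalExpansion b h j i y := by
  set k : Matrix ι ι ℝ := Matrix.of fun i j =>
    (1 / 2) * pd (timeBasis b) (Sum.inl ()) (fun z => h z i j) y with hk
  have hks : k.IsSymm := by
    ext i j
    simp only [hk, Matrix.transpose_apply, Matrix.of_apply]
    congr 1
    refine pd_congr _ ?_ _
    filter_upwards [hU.mem_nhds hy] with z hz
    simpa using (hpos z hz).isHermitian.apply i j
  have hθ : ∀ i j, normalExpansion b h i j y = ((h y)⁻¹ * k) i j := fun i j => by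
    rw [normalExpansion, Matrix.mul_apply, Finset.mul_sum]
    refine Finset.sum_congr rfl fun l _ => ?_
    simp only [hk, Matrix.of_apply]
    ring
  have h0 := trace_mul_symm_sq_nonneg (hpos y hy).inv hks
  simpa only [Matrix.trace, Matrix.diag, Matrix.mul_apply (M := (h y)⁻¹ * k), ← hθ] using h0

end NormalCoordinates

/-- A Lorentz form is positive on the nonzero vectors orthogonal to a timelike vector. -/
theorem IsLorentzForm.pos_of_orthogonal {W : Type*} [AddCommGroup W] [Module ℝ W]
    {B : W →ₗ[ℝ] W →ₗ[ℝ] ℝ} (hB : IsLorentzForm B) {u w : W} (hu : B u u < 0) (huw : B u w = 0)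
    (hw : w ≠ 0) : 0 < B w w := by
  obtain ⟨hs, v, hv, hpos⟩ := hB
  by_contra! hle
  have hvu : B v u ≠ 0 := fun h0 =>
    absurd (hpos u h0 (by rintro rfl; simp at hu)) (not_lt.2 hu.le)
  have hwu : B w u = 0 := by rw [hs, huw]
  -- This combination of `u` and `w` is orthogonal to `v` and nonzero, so its square is positive.
  -- Expanding with `u` ⊥ `w` makes the square nonpositive if `B w w ≤ 0`.
  have hz : B v (B v w • u - B v u • w) = 0 := by
    simp only [map_sub, map_smul, smul_eq_mul]
    ring
  have hz0 : B v w • u - B v u • w ≠ 0 := fun h0 => by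
    have h1 : B u (B v w • u - B v u • w) = B v w * B u u := by
      simp [huw]
    rw [h0, map_zero] at h1
    have h2 : B v w = 0 := by
      rcases mul_eq_zero.1 h1.symm with h | h
      · exact h
      · exact absurd h hu.ne
    rw [h2, zero_smul, zero_sub, neg_eq_zero] at h0
    exact (smul_ne_zero hvu hw) h0
  have h := hpos _ hz hz0
  have e : B (B v w • u - B v u • w) (B v w • u - B v u • w) =
      (B v w) ^ 2 * B u u + (B v u) ^ 2 * B w w := by
    simp [huw, hwu]
    ring
  rw [e] at h
  nlinarith [mul_nonneg (sq_nonneg (B v w)) (neg_nonneg.2 hu.le),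
    mul_nonneg (sq_nonneg (B v u)) (neg_nonneg.2 hle)]

/-! ### The foliated spacetime in product charts -/

section Spacetime

variable {S : Type*} [TopologicalSpace S] [ChartedSpace E3 S] [IsManifold 𝓘(ℝ, E3) ∞ S]

omit [IsManifold 𝓘(ℝ, E3) ∞ S] in
theorem extChartAt_I4_target (s : ℝ) (x : S) :
    (extChartAt I4 ((s, x) : ℝ × S)).target = Set.univ ×ˢ (extChartAt 𝓘(ℝ, E3) x).target := by
  rw [extChartAt_prod, PartialEquiv.prod_target, extChartAt_model_space_eq_id]
  rfl

theorem mdifferentiableAt_extChartAt_symm {x : S} {y : E3}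
    (hy : y ∈ (extChartAt 𝓘(ℝ, E3) x).target) :
    MDifferentiableAt 𝓘(ℝ, E3) 𝓘(ℝ, E3) (extChartAt 𝓘(ℝ, E3) x).symm y := by
  have : IsManifold 𝓘(ℝ, E3) 1 S := .of_le (n := ∞) (by simp)
  have h := mdifferentiableWithinAt_extChartAt_symm (I := 𝓘(ℝ, E3)) hy
  rwa [ModelWithCorners.range_eq_univ, mdifferentiableWithinAt_univ] at h

theorem mfderiv_extChartAt_symm_injective {x : S} {y : E3} (hy : y ∈ (extChartAt 𝓘(ℝ, E3) x).target) :
    Function.Injective (mfderiv 𝓘(ℝ, E3) 𝓘(ℝ, E3) (extChartAt 𝓘(ℝ, E3) x).symm y) := by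
  have : IsManifold 𝓘(ℝ, E3) 1 S := .of_le (n := ∞) (by simp)
  have h := isInvertible_mfderivWithin_extChartAt_symm (I := 𝓘(ℝ, E3)) hy
  rw [ModelWithCorners.range_eq_univ, mfderivWithin_univ] at h
  exact h.injective

theorem mfderiv_extChartAt_I4_symm (s : ℝ) {x : S} {q : ℝ × E3}
    (hq : q.2 ∈ (extChartAt 𝓘(ℝ, E3) x).target) (v : ℝ × E3) :
    (mfderiv 𝓘(ℝ, ℝ × E3) I4 (extChartAt I4 ((s, x) : ℝ × S)).symm q v : ℝ × E3) =
      (v.1, mfderiv 𝓘(ℝ, E3) 𝓘(ℝ, E3) (extChartAt 𝓘(ℝ, E3) x).symm q.2 v.2) := by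
  have h1 : HasMFDerivAt 𝓘(ℝ, ℝ × E3) 𝓘(ℝ, ℝ) (Prod.fst : ℝ × E3 → ℝ) q
      (ContinuousLinearMap.fst ℝ ℝ E3) := hasFDerivAt_fst.hasMFDerivAt
  have h2 : HasMFDerivAt 𝓘(ℝ, ℝ × E3) 𝓘(ℝ, E3) (Prod.snd : ℝ × E3 → E3) q
      (ContinuousLinearMap.snd ℝ ℝ E3) := hasFDerivAt_snd.hasMFDerivAt
  have h3 := (mdifferentiableAt_extChartAt_symm hq).hasMFDerivAt.comp q h2
  exact congrArg (fun L : ℝ × E3 →L[ℝ] ℝ × E3 => L v) (h1.prodMk h3).mfderiv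

/-- The matrix of the spatial metric in the chart at `x`, as a function of time and coordinates. -/
def spatialCoord (g : BilinField I4 (ℝ × S)) (x : S) (q : ℝ × E3) : Matrix (Fin 3) (Fin 3) ℝ :=
  metricCoord 𝓘(ℝ, E3) b3 (spatialMetric g q.1) x q.2

theorem coordVec_inl (s : ℝ) {x : S} {q : ℝ × E3} (hq : q.2 ∈ (extChartAt 𝓘(ℝ, E3) x).target) :
    coordVec I4 b4 ((s, x) : ℝ × S) q (Sum.inl ()) = timeVec (q.1, (extChartAt 𝓘(ℝ, E3) x).symm q.2) := by
  refine (mfderiv_extChartAt_I4_symm s hq _).trans ?_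
  simp only [b4, Module.Basis.prod_apply_inl_fst, Module.Basis.prod_apply_inl_snd,
    Module.Basis.singleton_apply]
  exact congrArg (Prod.mk (1 : ℝ)) (map_zero _)

theorem coordVec_inr (s : ℝ) {x : S} {q : ℝ × E3} (hq : q.2 ∈ (extChartAt 𝓘(ℝ, E3) x).target)
    (i : Fin 3) :
    coordVec I4 b4 ((s, x) : ℝ × S) q (Sum.inr i) =
      sliceVec q.1 _ (coordVec 𝓘(ℝ, E3) b3 x q.2 i) := by
  refine (mfderiv_extChartAt_I4_symm s hq _).trans ?_
  simp only [b4, Module.Basis.prod_apply_inr_fst, Module.Basis.prod_apply_inr_snd]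
  rfl

/-- The coordinates, in the chart at `x`, of the events with time in `T`. -/
def coordDomain (T : Set ℝ) (x : S) : Set (ℝ × E3) := T ×ˢ (extChartAt 𝓘(ℝ, E3) x).target

omit [IsManifold 𝓘(ℝ, E3) ∞ S] in
theorem isOpen_coordDomain {T : Set ℝ} (hT : IsOpen T) (x : S) : IsOpen (coordDomain T x) :=
  hT.prod (isOpen_extChartAt_target x)

omit [IsManifold 𝓘(ℝ, E3) ∞ S] in
theorem mem_coordDomain {T : Set ℝ} {s : ℝ} (hs : s ∈ T) (x : S) :
    (s, extChartAt 𝓘(ℝ, E3) x x) ∈ coordDomain T x :=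
  ⟨hs, mem_extChartAt_target x⟩

variable {T : Set ℝ} {g : BilinField I4 (ℝ × S)} {u : ∀ p : ℝ × S, TangentSpace I4 p}

omit [IsManifold 𝓘(ℝ, E3) ∞ S] in
theorem IsFlowOrthogonal.timeVec_timeVec (hfol : IsFlowOrthogonal T g u) {s : ℝ} (hs : s ∈ T)
    (x : S) : g (s, x) (timeVec (s, x)) (timeVec (s, x)) = -1 := by
  have hp : (s, x) ∈ region S T := ⟨hs, trivial⟩
  rw [← hfol.comoving _ hp, hfol.unit _ hp]

omit [IsManifold 𝓘(ℝ, E3) ∞ S] in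
theorem IsFlowOrthogonal.timeVec_sliceVec (hfol : IsFlowOrthogonal T g u) {s : ℝ} (hs : s ∈ T)
    (x : S) (v : TangentSpace 𝓘(ℝ, E3) x) : g (s, x) (timeVec (s, x)) (sliceVec s x v) = 0 := by
  have hp : (s, x) ∈ region S T := ⟨hs, trivial⟩
  rw [← hfol.comoving _ hp, hfol.orthogonal s hs]

/-- In the charts of `ℝ × S` the metric has the form `-dt² + h_{ij} dx^i dx^j`. -/
theorem metricCoord_eq_normalMetric (hg : IsSpacetimeMetric T g) (hfol : IsFlowOrthogonal T g u)
    (s : ℝ) {x : S} {q : ℝ × E3} (hq : q ∈ coordDomain T x) :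
    metricCoord I4 b4 g ((s, x) : ℝ × S) q = normalMetric (spatialCoord g x) q := by
  have hp : (q.1, (extChartAt 𝓘(ℝ, E3) x).symm q.2) ∈ region S T := ⟨hq.1, trivial⟩
  ext (⟨⟩ | i) (⟨⟩ | j)
  · rw [metricCoord, Matrix.of_apply, coordVec_inl s hq.2]
    exact hfol.timeVec_timeVec hq.1 _
  · rw [metricCoord, Matrix.of_apply, coordVec_inl s hq.2, coordVec_inr s hq.2]
    exact hfol.timeVec_sliceVec hq.1 _ _
  · rw [metricCoord, Matrix.of_apply, coordVec_inl s hq.2, coordVec_inr s hq.2]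
    exact ((hg.lorentz _ hp).1 _ _).trans (hfol.timeVec_sliceVec hq.1 _ _)
  · rw [metricCoord, Matrix.of_apply, coordVec_inr s hq.2, coordVec_inr s hq.2]
    rfl

theorem contDiffOn_spatialCoord (hg : IsSpacetimeMetric T g) (hfol : IsFlowOrthogonal T g u)
    (x : S) (i j : Fin 3) :
    ContDiffOn ℝ ∞ (fun q => spatialCoord g x q i j) (coordDomain T x) := by
  intro q hq
  -- The time factor of the chart is the identity, so the time of the base point is irrelevant;
  -- `q.1` is chosen because it lies in `T`.
  have hs := hg.smooth (q.1, x) ⟨hq.1, trivial⟩ (Sum.inr i) (Sum.inr j)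
  rw [extChartAt_I4_target] at hs
  have hsub : coordDomain T x ⊆ (Set.univ ×ˢ (extChartAt 𝓘(ℝ, E3) x).target) ∩
      (extChartAt I4 ((q.1, x) : ℝ × S)).symm ⁻¹' region S T :=
    fun r hr => ⟨⟨trivial, hr.2⟩, hr.1, trivial⟩
  refine ((hs.mono hsub).congr fun r hr => ?_) q hq
  rw [metricCoord_eq_normalMetric hg hfol q.1 hr]
  rfl

/-- Vectors tangent to a slice are orthogonal to the timelike ∂_t, so the Lorentz form is positive
on them. Injectivity of the derivative of the inverse chart carries this to coordinates. -/
theorem posDef_spatialCoord (hg : IsSpacetimeMetric T g) (hfol : IsFlowOrthogonal T g u)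
    {x : S} {q : ℝ × E3} (hq : q ∈ coordDomain T x) : (spatialCoord g x q).PosDef := by
  set z : S := (extChartAt 𝓘(ℝ, E3) x).symm q.2
  have hL : IsLorentzForm (g (q.1, z)) := hg.lorentz _ ⟨hq.1, trivial⟩
  refine Matrix.PosDef.of_dotProduct_mulVec_pos ?_ fun v hv => ?_
  · ext i j
    exact hL.1 _ _
  · set w : E3 := ∑ i, v i • b3 i
    have hw : w ≠ 0 := fun h0 => hv <| funext fun i =>
      Fintype.linearIndependent_iff.1 b3.linearIndependent v h0 i
    set L := mfderiv 𝓘(ℝ, E3) 𝓘(ℝ, E3) (extChartAt 𝓘(ℝ, E3) x).symm q.2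
    have hLw : L w ≠ 0 := fun h0 => hw (mfderiv_extChartAt_symm_injective hq.2
      (h0.trans (map_zero L).symm))
    have hne : sliceVec q.1 z (L w) ≠ 0 := fun h0 => hLw (congrArg Prod.snd h0)
    have hpos := hL.pos_of_orthogonal (u := timeVec (q.1, z))
      (by rw [hfol.timeVec_timeVec hq.1]; norm_num) (hfol.timeVec_sliceVec hq.1 z (L w)) hne
    have e : L w = ∑ i, v i • coordVec 𝓘(ℝ, E3) b3 x q.2 i :=
      (map_sum L _ _).trans (Finset.sum_congr rfl fun i _ => map_smul L _ _)
    have e' : g (q.1, z) (sliceVec q.1 z (L w)) (sliceVec q.1 z (L w)) =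
        spatialMetric g q.1 z (L w) (L w) := rfl
    rw [e', e] at hpos
    simp only [map_sum, map_smul, LinearMap.sum_apply, LinearMap.smul_apply, smul_eq_mul] at hpos
    refine hpos.trans_eq ?_
    simp only [dotProduct, Matrix.mulVec, Finset.mul_sum]
    refine Finset.sum_congr rfl fun i _ => Finset.sum_congr rfl fun j _ => ?_
    rw [mul_comm (v j)]
    exact congrArg (fun a => v i * (a * v j)) (hL.1 _ _)

theorem det_spatialCoord_ne_zero (hg : IsSpacetimeMetric T g) (hfol : IsFlowOrthogonal T g u)
    (x : S) : ∀ q ∈ coordDomain T x, (spatialCoord g x q).det ≠ 0 :=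
  fun _ hq => (posDef_spatialCoord hg hfol hq).det_pos.ne'

/-! ### Expansion and Einstein equation at an event -/

section Event

variable (hT : IsOpen T) (hg : IsSpacetimeMetric T g) (hfol : IsFlowOrthogonal T g u)
  {s : ℝ} (hs : s ∈ T) (x : S)

include hT hg hfol hs

theorem metricCoord_eventuallyEq :
    metricCoord I4 b4 g ((s, x) : ℝ × S) =ᶠ[nhds (s, extChartAt 𝓘(ℝ, E3) x x)]
      normalMetric (spatialCoord g x) := by
  filter_upwards [(isOpen_coordDomain hT x).mem_nhds (mem_coordDomain hs x)] with q hq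
  exact metricCoord_eq_normalMetric hg hfol s hq

omit hT hg hs in
theorem lowerCoord_inl {q : ℝ × E3} (hq : q ∈ coordDomain T x) :
    lowerCoord I4 b4 g u ((s, x) : ℝ × S) q (Sum.inl ()) = -1 := by
  have hp : (q.1, (extChartAt 𝓘(ℝ, E3) x).symm q.2) ∈ region S T := ⟨hq.1, trivial⟩
  rw [lowerCoord, coordVec_inl s hq.2]
  exact (congrArg (fun v => g _ v _) (hfol.comoving _ hp)).trans (hfol.timeVec_timeVec hq.1 _)

omit hT hg hs in
theorem lowerCoord_inr {q : ℝ × E3} (hq : q ∈ coordDomain T x) (i : Fin 3) :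
    lowerCoord I4 b4 g u ((s, x) : ℝ × S) q (Sum.inr i) = 0 := by
  rw [lowerCoord, coordVec_inr s hq.2]
  exact hfol.orthogonal _ hq.1 _ _

/-- The components u_j vanish near the event and u_t = -1, so ∇_i u_j reduces to Γ^t_{ij}. -/
theorem nablaAt_inr_inr (i j : Fin 3) :
    nablaAt I4 b4 g u ((s, x) : ℝ × S) (Sum.inr i) (Sum.inr j) =
      (1 / 2) * pd b4 (Sum.inl ()) (fun z => spatialCoord g x z i j)
        (s, extChartAt 𝓘(ℝ, E3) x x) := by
  have hy := mem_coordDomain hs x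
  have hev := (isOpen_coordDomain hT x).mem_nhds hy
  have hd := det_spatialCoord_ne_zero hg hfol x _ hy
  change covDeriv b4 _ _ _ _ (s, extChartAt 𝓘(ℝ, E3) x x) = _
  rw [covDeriv, pd_congr b4 (f' := fun _ => 0), pd_const]
  · simp only [christoffel_congr b4 (metricCoord_eventuallyEq hT hg hfol hs x),
      Fintype.sum_sum_type, lowerCoord_inr hfol (s := s) x hy, Finset.univ_unique, Finset.sum_singleton,
      PUnit.default_eq_unit, lowerCoord_inl hfol (s := s) x hy]
    rw [b4, christoffel_inl_inr_inr b3 hd]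
    simp
  · filter_upwards [hev] with q hq
    exact lowerCoord_inr hfol (s := s) x hq j

theorem expansion_eq :
    expansion g u s x =
      ∑ i, normalExpansion b3 (spatialCoord g x) i i (s, extChartAt 𝓘(ℝ, E3) x x) := by
  refine Finset.sum_congr rfl fun i _ => ?_
  simp only [expansionTensor, extrinsicCurv, nablaAt_inr_inr hT hg hfol hs, normalExpansion,
    Finset.mul_sum, ← Finset.sum_neg_distrib]
  refine Finset.sum_congr rfl fun k _ => ?_
  change -((spatialCoord g x (s, extChartAt 𝓘(ℝ, E3) x x))⁻¹ i k * _) = _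
  rw [b4]
  ring

/-- The Hamiltonian constraint of the Einstein equation with dust source. -/
theorem hamiltonian_constraint {G Λ : ℝ} {ρ : ℝ × S → ℝ} (hEin : SolvesEinsteinDust G Λ T g u ρ) :
    spatialScalarCurv g s x + expansion g u s x ^ 2 -
      ∑ i, ∑ j, normalExpansion b3 (spatialCoord g x) i j (s, extChartAt 𝓘(ℝ, E3) x x) *
        normalExpansion b3 (spatialCoord g x) j i (s, extChartAt 𝓘(ℝ, E3) x x) =
      16 * Real.pi * G * ρ (s, x) + 2 * Λ := by
  have hy := mem_coordDomain hs x
  have hU := isOpen_coordDomain hT x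
  have hd := det_spatialCoord_ne_zero hg hfol x
  have hmet := metricCoord_eventuallyEq hT hg hfol hs x
  have hp : (s, x) ∈ region S T := ⟨hs, trivial⟩
  have gauss := normalMetric_gauss b3 hU (contDiffOn_spatialCoord hg hfol x) hd hy
    ((Matrix.conjTranspose_eq_transpose_of_trivial _).symm.trans
      (posDef_spatialCoord hg hfol hy).isHermitian)
  rw [← expansion_eq hT hg hfol hs x] at gauss
  have hsc : scalarCurv b3 (fun z => spatialCoord g x (s, z)) (extChartAt 𝓘(ℝ, E3) x x) =
      spatialScalarCurv g s x := rfl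
  -- The inverse metric is block diagonal, so R = -R_tt + h^{ij} R_ij.
  have hR : scalarCurvAt I4 b4 g ((s, x) : ℝ × S) =
      -ricci b4 (normalMetric (spatialCoord g x)) (Sum.inl ()) (Sum.inl ())
        (s, extChartAt 𝓘(ℝ, E3) x x) +
      ∑ i, ∑ j, (spatialCoord g x (s, extChartAt 𝓘(ℝ, E3) x x))⁻¹ i j *
        ricci b4 (normalMetric (spatialCoord g x)) (Sum.inr i) (Sum.inr j)
          (s, extChartAt 𝓘(ℝ, E3) x x) := by
    change scalarCurv b4 _ (s, extChartAt 𝓘(ℝ, E3) x x) = _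
    simp only [scalarCurv, ricci_congr b4 hmet, hmet.eq_of_nhds, inv_normalMetric (hd _ hy)]
    simp
  have h00 : metricCoord I4 b4 g ((s, x) : ℝ × S) (s, extChartAt 𝓘(ℝ, E3) x x)
      (Sum.inl ()) (Sum.inl ()) = -1 := by
    rw [hmet.eq_of_nhds]
    simp [normalMetric]
  have hric : ricciAt I4 b4 g ((s, x) : ℝ × S) (Sum.inl ()) (Sum.inl ()) =
      ricci b4 (normalMetric (spatialCoord g x)) (Sum.inl ()) (Sum.inl ())
        (s, extChartAt 𝓘(ℝ, E3) x x) := ricci_congr b4 hmet _ _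
  have hstress : dustStress g u ρ (s, x) (Sum.inl ()) (Sum.inl ()) = ρ (s, x) := by
    have h : lowerCoord I4 b4 g u ((s, x) : ℝ × S) (extChartAt I4 ((s, x) : ℝ × S) (s, x))
        (Sum.inl ()) = -1 := lowerCoord_inl hfol (s := s) x hy
    rw [dustStress, h]
    ring
  -- Since g_tt = u_t = -1, this component reads R_tt + ½R - Λ = 8πGρ. Doubled, its curvature part
  -- is the left side of `gauss`.
  have hE := hEin (s, x) hp (Sum.inl ()) (Sum.inl ())
  rw [hric, hR, hstress] at hE
  change _ - _ * metricCoord I4 b4 g ((s, x) : ℝ × S) (s, extChartAt 𝓘(ℝ, E3) x x) _ _ +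
    Λ * metricCoord I4 b4 g ((s, x) : ℝ × S) (s, extChartAt 𝓘(ℝ, E3) x x) _ _ = _ at hE
  rw [h00] at hE
  rw [hsc] at gauss
  change ricci b4 _ _ _ _ + ∑ i, ∑ j, _ * ricci b4 _ _ _ _ = _ at gauss
  linarith

end Event

/-- On a slice with vanishing scalar curvature the expansion of dust does not vanish. -/
theorem expansion_ne_zero_of_flat {G Λ : ℝ} (hG : 0 < G) (hΛ : 0 ≤ Λ) (hT : IsOpen T)
    (hg : IsSpacetimeMetric T g) (hfol : IsFlowOrthogonal T g u) {ρ : ℝ × S → ℝ}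
    (hEin : SolvesEinsteinDust G Λ T g u ρ) {s : ℝ} (hs : s ∈ T) {x : S} (hρ : 0 < ρ (s, x))
    (hflat : spatialScalarCurv g s x = 0) : expansion g u s x ≠ 0 := by
  intro h0
  have h1 := hamiltonian_constraint hT hg hfol hs x hEin
  have h2 := normalExpansion_sq_nonneg b3 (isOpen_coordDomain hT x) (mem_coordDomain hs x)
    fun z hz => posDef_spatialCoord hg hfol hz
  have h3 : 0 < 16 * Real.pi * G * ρ (s, x) := by positivity
  -- The constraint now equates a nonpositive number with a positive one.
  rw [hflat, h0] at h1
  linarith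

theorem continuousOn_expansion (hT : IsOpen T) (hg : IsSpacetimeMetric T g)
    (hfol : IsFlowOrthogonal T g u) (x : S) : ContinuousOn (fun s => expansion g u s x) T := by
  have h : ContinuousOn (fun s => ∑ i, normalExpansion b3 (spatialCoord g x) i i
      (s, extChartAt 𝓘(ℝ, E3) x x)) T :=
    continuousOn_finsetSum _ fun i _ => (contDiffOn_normalExpansion b3 (isOpen_coordDomain hT x)
      (contDiffOn_spatialCoord hg hfol x) (det_spatialCoord_ne_zero hg hfol x) i i).continuousOn.comp
      (by fun_prop) fun s hs => mem_coordDomain hs x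
  exact h.congr fun s hs => expansion_eq hT hg hfol hs x

end Spacetime

end DustCosmology

end

/-! ### Positivity up to the final time -/

theorem proposition1
    {S : Type*} [TopologicalSpace S] [ChartedSpace DustCosmology.E3 S]
    [IsManifold 𝓘(ℝ, DustCosmology.E3) ∞ S]
    (G Λ : ℝ) (hG : 0 < G) (hΛ : 0 ≤ Λ)
    (T : Set ℝ) (hT : IsOpen T)
    (g : DustCosmology.BilinField DustCosmology.I4 (ℝ × S))
    (u : ∀ p : ℝ × S, TangentSpace DustCosmology.I4 p)
    (ρ : ℝ × S → ℝ)
    (hg : DustCosmology.IsSpacetimeMetric T g)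
    (hfol : DustCosmology.IsFlowOrthogonal T g u)
    (hirr : DustCosmology.IsIrrotational T g u)
    (hEin : DustCosmology.SolvesEinsteinDust G Λ T g u ρ)
    (hρ : ∀ p ∈ DustCosmology.region S T, 0 < ρ p)
    (ti t : ℝ) (hti : ti < t) (htT : Set.Icc ti t ⊆ T)
    (hflat : ∀ X : S, ∀ t' ∈ Set.Icc ti t, DustCosmology.spatialScalarCurv g t' X = 0)
    (hexp : ∀ X : S, ∀ t' ∈ Set.Ico ti t, 0 < DustCosmology.expansion g u t' X) :
    (∀ X : S, DustCosmology.expansion g u t X ≠ 0) ∧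
      ∀ X : S, ∀ t' ∈ Set.Icc ti t, 0 < DustCosmology.expansion g u t' X := by
  have hne : ∀ X : S, DustCosmology.expansion g u t X ≠ 0 := fun X =>
    have ht : t ∈ Set.Icc ti t := ⟨hti.le, le_rfl⟩
    DustCosmology.expansion_ne_zero_of_flat hG hΛ hT hg hfol hEin (htT ht)
      (hρ _ ⟨htT ht, trivial⟩) (hflat X t ht)
  refine ⟨hne, fun X t' ht' => ?_⟩
  rcases ht'.2.lt_or_eq with hlt | rfl
  · exact hexp X t' ⟨ht'.1, hlt⟩
  -- At the final time, continuity from the left gives Θ ≥ 0, and equality is already excluded.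
  · refine lt_of_le_of_ne ?_ (hne X).symm
    have hc : ContinuousWithinAt (fun s => DustCosmology.expansion g u s X) (Set.Ico ti t') t' :=
      ((DustCosmology.continuousOn_expansion hT hg hfol X) t' (htT ht')).mono
        (Set.Ico_subset_Icc_self.trans htT)
    have hcl : t' ∈ closure (Set.Ico ti t') := by
      rw [closure_Ico hti.ne]
      exact ht'
    have : (nhdsWithin t' (Set.Ico ti t')).NeBot := mem_closure_iff_nhdsWithin_neBot.1 hcl
    exact ge_of_tendsto hc (eventually_nhdsWithin_of_forall fun s hs => (hexp X s hs).le)
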